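/- Conventions. $\lim(\omega_1)$ is the set of nonzero limit ordinals below $\omega_1$; for a set $a$ of ordinals, $a(i)$ is the $i$-th element of $a$ in increasing order and $a[n]=\{a(i)\mid i<n\}$. A \emph{disjoint type of width $n$} is a function $t:2n\to 2$ that takes each of the values $0,1$ exactly $n$ times. For disjoint $n$-element sets of ordinals $a,b$ with $a\cup b=\{\alpha_0<\dots<\alpha_{2n-1}\}$, $\mathrm{type}(a,b)$ is the disjoint type $t$ with $a=\{\alpha_i\mid t(i)=0\}$ and $b=\{\alpha_i\mid t(i)=1\}$; the \emph{depth} of $t$ is then the least $k<n$ such that $a<b(k)$ or $b<a(k)$ (and $0$ if $n=0$), and $\bar t=1-t$ is the opposite type. A \emph{$C$-sequence} is a sequence $\vec C=\langle C_\alpha\mid\alpha\in\lim(\omega_1)\rangle$ in which each $C_\alpha$ is a cofinal subset of $\alpha$ of order type $\omega$. Given a sequence $\vec t=\langle t_k\mid k<\omega\rangle$ of disjoint types, a $C$-sequence $\vec C$ is a \emph{$\vec t$-guessing sequence} if for every $f:\omega_1\to\omega$ there are $\alpha<\beta$ in $\lim(\omega_1)$ and $k<\omega$ such that $f(\alpha)=f(\beta)=k$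 and, with $n=\mathrm{width}(t_k)$, $\mathrm{type}(C_\alpha[n],C_\beta[n])\in\{t_k,\bar t_k\}$. \emph{Disjoint type guessing} ($\mathsf{DTG}$) says that for every sequence $\vec t$ of disjoint types there is a $\vec t$-guessing sequence. \emph{Club guessing} says that there is a $C$-sequence $\vec C$ such that for every club $D\subseteq\omega_1$ there is $\alpha\in\lim(\omega_1)$ with $C_\alpha\subseteq D$. $\mathsf{PFA}(\omega_1)$ says that for every proper forcing poset $\mathbb P$ of cardinality $\omega_1$ and every collection $\{D_\alpha\mid\alpha<\omega_1\}$ of dense subsets of $\mathbb P$ there is a filter $G\subseteq\mathbb P$ with $G\cap D_\alpha\neq\emptyset$ for all $\alpha<\omega_1$. Theorem. (1) Suppose that $\mathsf{PFA}(\omega_1)$ holds and that $\vec t=\langle t_k\mid k<\omega\rangle$ is a sequence of disjoint types with $\sup\{\mathrm{depth}(t_k)\mid k<\omega\}=\omega$. Then there is no $\vec t$-guessing sequence, i.e., no $C$-sequence is a $\vec t$-guessing sequence. (2) Consequently, $\mathsf{PFA}(\omega_1)$ implies that $\mathsf{DTG}$ fails. (3) Club guessing, on the other hand, implies $\mathsf{DTG}$.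 -/

import Mathlib

open scoped Ordinal Cardinal

/-! ### The `k`-th element of a set of ordinals -/

/-- `x = a(k)`: the point `x` belongs to `a`, and exactly `k` elements of `a` lie below `x`. -/
def IsNth {X : Type*} [LinearOrder X] (a : Set X) (k : ℕ) (x : X) : Prop :=
  x ∈ a ∧ (a ∩ Set.Iio x).encard = k

/-- `a[n] = {a(i) | i < n}`: the set of the first `n` elements of `a`. -/
def firstElems {X : Type*} [LinearOrder X] (a : Set X) (n : ℕ) : Set X :=
  {x | ∃ i < n, IsNth a i x}

/-! ### Disjoint types -/

/-- A disjoint type of width `n`: a map `t : 2n → 2` taking each of its two values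
exactly `n` times. -/
structure DisjointType where
  width : ℕ
  val : Fin (2 * width) → Fin 2
  card_zero : (Finset.univ.filter fun i => val i = 0).card = width
  card_one : (Finset.univ.filter fun i => val i = 1).card = width

namespace DisjointType

/-- The opposite type `i ↦ 1 - t(i)`. -/
def opposite (t : DisjointType) : DisjointType where
  width := t.width
  val := fun i => 1 - t.val i
  card_zero := by
    refine Eq.trans ?_ t.card_one
    congr 1
    ext i
    simp only [Finset.mem_filter, Finset.mem_univ, true_and]
    generalize t.val i = c
    revert c
    decide
  card_one := by
    refine Eq.trans ?_ t.card_zero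
    congr 1
    ext i
    simp only [Finset.mem_filter, Finset.mem_univ, true_and]
    generalize t.val i = c
    revert c
    decide

/-- The positions `i < 2n` at which `t` takes the value `c`. -/
def positions (t : DisjointType) (c : Fin 2) : Set (Fin (2 * t.width)) :=
  {i | t.val i = c}

/-- `type(a, b) = t`: if `e` is the increasing enumeration of `a ∪ b` in length `2n`, then `a` is
the set of all `e i` with `t i = 0`, and `b` is the set of all `e i` with `t i = 1`. In particular
`a` and `b` are disjoint and have `n` elements each. -/
def IsTypeOf (t : DisjointType) {X : Type*} [LinearOrder X] (a b : Set X) : Prop :=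
  ∃ e : Fin (2 * t.width) → X,
    StrictMono e ∧ a = e '' t.positions 0 ∧ b = e '' t.positions 1

/-- For sets `a`, `b` with `n` elements each: the least `k < n` such that `a < b(k)` or
`b < a(k)`. -/
noncomputable def depthOfPair {X : Type*} [LinearOrder X] (n : ℕ) (a b : Set X) : ℕ :=
  sInf {k | k < n ∧ ((∃ x, IsNth b k x ∧ ∀ y ∈ a, y < x) ∨ (∃ x, IsNth a k x ∧ ∀ y ∈ b, y < x))}

/-- The depth of `t`, computed on the pair of sets of positions of the two values, whose type is
`t`. By `depthOfPair_eq_depth`, any other pair of type `t` gives the same number. (For the type of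
width `0` there is no such `k`, and the value is `0`.) -/
noncomputable def depth (t : DisjointType) : ℕ :=
  depthOfPair t.width (t.positions 0) (t.positions 1)

theorem isTypeOf_positions (t : DisjointType) : t.IsTypeOf (t.positions 0) (t.positions 1) :=
  ⟨id, strictMono_id, by simp, by simp⟩

theorem isNth_image {X Y : Type*} [LinearOrder X] [LinearOrder Y] {e : X → Y} (he : StrictMono e)
    (a : Set X) (k : ℕ) (x : X) : IsNth (e '' a) k (e x) ↔ IsNth a k x := by
  have h : e '' a ∩ Set.Iio (e x) = e '' (a ∩ Set.Iio x) := by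
    ext y
    constructor
    · rintro ⟨⟨z, hz, rfl⟩, hy⟩
      exact ⟨z, ⟨hz, he.lt_iff_lt.1 hy⟩, rfl⟩
    · rintro ⟨z, ⟨hz, hzx⟩, rfl⟩
      exact ⟨⟨z, hz, rfl⟩, he hzx⟩
  unfold IsNth
  rw [h, he.injective.encard_image, he.injective.mem_set_image]

theorem depthOfPair_eq_depth (t : DisjointType) {X : Type*} [LinearOrder X] {a b : Set X}
    (h : t.IsTypeOf a b) : depthOfPair t.width a b = t.depth := by
  obtain ⟨e, he, rfl, rfl⟩ := h
  have key : ∀ (k : ℕ) (s u : Set (Fin (2 * t.width))),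
      (∃ x, IsNth (e '' s) k x ∧ ∀ y ∈ e '' u, y < x) ↔ (∃ x, IsNth s k x ∧ ∀ y ∈ u, y < x) := by
    intro k s u
    constructor
    · rintro ⟨x, hx, hy⟩
      obtain ⟨z, -, rfl⟩ := hx.1
      exact ⟨z, (isNth_image he s k z).1 hx, fun y hyu => he.lt_iff_lt.1 (hy _ ⟨y, hyu, rfl⟩)⟩
    · rintro ⟨z, hz, hy⟩
      refine ⟨e z, (isNth_image he s k z).2 hz, ?_⟩
      rintro _ ⟨y, hyu, rfl⟩
      exact he (hy y hyu)
  unfold depth depthOfPair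
  simp only [key]

end DisjointType

/-! ### `C`-sequences and guessing -/

/-- The set `ω₁` of all countable ordinals. In it, `Order.IsSuccLimit α` says that `α` is a
(nonzero) limit ordinal, that is, `α ∈ lim(ω₁)`. -/
abbrev Omega1 : Type 1 := Set.Iio (ω₁ : Ordinal.{0})

/-- `C` is a `C`-sequence: for every `α ∈ lim(ω₁)`, the set `C α` is a cofinal subset of `α` of
order type `ω`. The values of `C` off `lim(ω₁)` play no role anywhere. -/
def IsCSequence (C : Omega1 → Set Omega1) : Prop :=
  ∀ α, Order.IsSuccLimit α →
    (∀ γ ∈ C α, γ < α) ∧ (∀ γ < α, ∃ δ ∈ C α, γ ≤ δ) ∧ typeLT (C α) = ω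

/-- `C` guesses the sequence `t` of disjoint types: for every `f : ω₁ → ω` there are `α < β` in
`lim(ω₁)` and `k` such that `f α = f β = k` and, with `n = width (t k)`, the type of
`(C_α[n], C_β[n])` is `t k` or its opposite. -/
def Guesses (C : Omega1 → Set Omega1) (t : ℕ → DisjointType) : Prop :=
  ∀ f : Omega1 → ℕ, ∃ (α β : Omega1) (k : ℕ),
    Order.IsSuccLimit α ∧ Order.IsSuccLimit β ∧ α < β ∧ f α = k ∧ f β = k ∧
      ((t k).IsTypeOf (firstElems (C α) (t k).width) (firstElems (C β) (t k).width) ∨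
        (t k).opposite.IsTypeOf (firstElems (C α) (t k).width) (firstElems (C β) (t k).width))

/-- `C` is a `t`-guessing sequence. -/
def IsGuessingSequence (C : Omega1 → Set Omega1) (t : ℕ → DisjointType) : Prop :=
  IsCSequence C ∧ Guesses C t

/-- Disjoint type guessing. -/
def DTG : Prop :=
  ∀ t : ℕ → DisjointType, ∃ C, IsGuessingSequence C t

/-- Club guessing: some `C`-sequence is such that every club `D ⊆ ω₁` contains some `C α`. -/
def ClubGuessing : Prop :=
  ∃ C, IsCSequence C ∧ ∀ D : Set Omega1, IsClub D → ∃ α, Order.IsSuccLimit α ∧ C α ⊆ D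

/-! ### Elementary submodels of `H(θ)` -/

/-- `H(θ)`: the sets contained in a transitive set of fewer than `θ` elements, that is, the sets
whose transitive closure has fewer than `θ` elements. -/
def HSet (θ : Cardinal.{0}) : Set ZFSet.{0} :=
  {x | ∃ T : ZFSet.{0}, T.IsTransitive ∧ x ⊆ T ∧ T.card < θ}

/-- The relation symbols of the language of set theory: one binary symbol. -/
inductive MemRel : ℕ → Type
  | mem : MemRel 2

/-- The language of set theory. -/
def setLanguage : FirstOrder.Language.{0, 0} := ⟨fun _ => Empty, MemRel⟩

/-- Every class of sets, with the true membership relation, is a structure for the language of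
set theory. -/
instance membershipStructure (A : Set ZFSet.{0}) : setLanguage.Structure A where
  funMap := fun f => Empty.elim f
  RelMap := fun r => match r with
    | MemRel.mem => fun v => (v 0 : ZFSet.{0}) ∈ (v 1 : ZFSet.{0})

/-- `M ≺ (A, ∈)`. -/
def IsElementarySubmodel (M A : Set ZFSet.{0}) : Prop :=
  ∃ N : setLanguage.ElementarySubstructure A, M = Subtype.val '' (N : Set A)

/-! ### Proper forcing and `PFA(ω₁)` -/

/-- A forcing poset: a set of conditions with a partial order. -/
structure ForcingPoset where
  carrier : ZFSet.{0}
  order : PartialOrder {p : ZFSet.{0} // p ∈ carrier}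

namespace ForcingPoset

/-- The conditions of `P`. -/
def Cond (P : ForcingPoset) : Type 1 := {p : ZFSet.{0} // p ∈ P.carrier}

instance (P : ForcingPoset) : PartialOrder P.Cond := P.order

/-- A condition, as a set. -/
def Cond.toZFSet {P : ForcingPoset} (p : P.Cond) : ZFSet.{0} := p.1

/-- `D` is dense: every condition has an extension in `D`. -/
def IsDense (P : ForcingPoset) (D : Set P.Cond) : Prop :=
  ∀ p : P.Cond, ∃ d ∈ D, d ≤ p

/-- `p` and `q` have a common extension. -/
def Compatible (P : ForcingPoset) (p q : P.Cond) : Prop :=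
  ∃ r : P.Cond, r ≤ p ∧ r ≤ q

/-- `q` is `(M, P)`-generic: for every dense `D ⊆ P` with `D ∈ M`, the set `D ∩ M` is predense
below `q`. -/
def IsGeneric (P : ForcingPoset) (M : Set ZFSet.{0}) (q : P.Cond) : Prop :=
  ∀ D ∈ M, D ⊆ P.carrier → P.IsDense {p | p.toZFSet ∈ D} →
    ∀ r ≤ q, ∃ d : P.Cond, d.toZFSet ∈ D ∧ d.toZFSet ∈ M ∧ P.Compatible d r

/-- `P` is proper: for all sufficiently large regular `θ` there is `x ∈ H(θ)` such that, for every
countable `M ≺ (H(θ), ∈, x)` and every `p ∈ M ∩ P`, there is an `(M, P)`-generic `q ≤ p`.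
(`M ≺ (H(θ), ∈, x)` means that `M ≺ (H(θ), ∈)` and `x ∈ M`.) -/
def IsProper (P : ForcingPoset) : Prop :=
  ∃ θ₀ : Cardinal.{0}, ∀ θ : Cardinal.{0}, θ₀ ≤ θ → θ.IsRegular →
    ∃ x ∈ HSet θ, ∀ M : Set ZFSet.{0}, M.Countable → IsElementarySubmodel M (HSet θ) → x ∈ M →
      ∀ p : P.Cond, p.toZFSet ∈ M → ∃ q ≤ p, P.IsGeneric M q

end ForcingPoset

/-- `PFA(ω₁)`: for every proper poset `P` of cardinality `ω₁` and all dense sets `D_α ⊆ P`,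
`α < ω₁`, there is a filter on `P` that meets every `D_α`. -/
def PFAOmega1 : Prop :=
  ∀ P : ForcingPoset, P.IsProper → P.carrier.card = ℵ₁ →
    ∀ D : Omega1 → Set P.Cond, (∀ α, P.IsDense (D α)) →
      ∃ G : Order.PFilter P.Cond, ∀ α, ((G : Set P.Cond) ∩ D α).Nonempty

/-!
Why the theorem holds.

**`PFA(ω₁)` excludes guessing sequences for types of unbounded depth.** Let `C` be a `C`-sequence.
For a type of depth `d > 0` and width `n`, attach to each limit `α` the interval from
`C_α(d - 1)` to `C_α(n - 1)`. If `C_α[n]` and `C_β[n]` realize the type or its opposite, then the two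
intervals overlap, by the minimality in the definition of depth, and their right endpoints differ,
as the two sets are disjoint (`DisjointType.IsTypeOf.overlap`). So it suffices to choose for every
`α` an index `f α = k` such that overlapping intervals with the same index have the same right
endpoint. As the depths are unbounded, the left endpoints of the intervals available at `α` converge
to `α`.

Such an `f` is added by finite conditions (`IntervalCond`): a finite piece of `f`, together with a
finite set of points that may not split any chosen interval. For properness, let `M` be a countable
elementary submodel with `M ∩ ω₁ = δ`. Adding the point `δ` to a condition in `M` makes it generic:
in an extension `r`, each chosen interval lies entirely below `δ` or entirely in `[δ, ω₁)`, so the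
intervals below `δ` are finitely many parameters in `M`, and elementarity gives in `M` a condition
of the given dense set which extends the part of `r` in `M` and whose new intervals either equal one
of these or lie beyond all of them. Such a condition is compatible with `r`
(`IntervalCond.exists_info`). Of elementarity only this is used: one set `x` can code countably many
functions on `ω₁`, under which every submodel containing `x` is then closed
(`exists_code_closed`), and two intersecting members of `M` meet inside `M`. This turns
`PFA(ω₁)` into a statement about closed countable sets of ordinals (`PFAOmega1.exists_filter`).

**`PFA(ω₁)` refutes `DTG`,** because the alternating types have unbounded depth
(`depth_alternatingType`).

**Club guessing implies `DTG`,** with the same `C`. Given `f`, consider for each `k` the family of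
the sets `C_α[n]`, `n = width (t k)`, with `f α = k`. If it is rich, in the sense that its members
can be built up point by point with unboundedly many choices for each point, then it contains pairs
interleaved in any pattern (`Rich.exists_interleaved`). For the families that are not rich,
functions bounding the choices have a club of closure points, and no sequence of closure points
enumerates a member of the family (`exists_rich_of_closurePoints`). Hence if `C_α` is contained in
that club and `k = f α`, then the `k`-th family is rich.
-/

/-! ### Elementary submodels and definable witnesses -/

theorem mem_HSet_of_mem {θ : Cardinal.{0}} {x y : ZFSet.{0}} (hx : x ∈ HSet θ) (hy : y ∈ x) :
    y ∈ HSet θ := by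
  obtain ⟨T, hT, hxT, hc⟩ := hx
  exact ⟨T, hT, hT.subset_of_mem (hxT hy), hc⟩

theorem exists_forall_mem_HSet (x : ZFSet.{0}) : ∃ θ₀ : Cardinal.{0}, ∀ θ, θ₀ ≤ θ → x ∈ HSet θ :=
  ⟨Order.succ (ZFSet.vonNeumann x.rank).card, fun _ hθ => ⟨_, ZFSet.isTransitive_vonNeumann _,
    ZFSet.subset_vonNeumann_self x, (Order.lt_succ _).trans_le hθ⟩⟩

section Formulas

open FirstOrder FirstOrder.Language

/-- The Tarski–Vaught property: a one-variable condition on `A` with parameters in an elementary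
submodel `M` has a solution in `M` as soon as it has one in `A`. -/
theorem IsElementarySubmodel.exists_realize {M A : Set ZFSet.{0}} (hM : IsElementarySubmodel M A)
    {n : ℕ} (φ : setLanguage.BoundedFormula (Fin n) 1) (v : Fin n → A) (hv : ∀ i, (v i : ZFSet) ∈ M)
    (b : A) (hb : φ.Realize v (Fin.snoc default b)) :
    ∃ c : A, (c : ZFSet) ∈ M ∧ φ.Realize v (Fin.snoc default c) := by
  obtain ⟨N, rfl⟩ := hM
  have hv' : ∀ i, v i ∈ N := by
    intro i
    obtain ⟨a, ha, h⟩ := hv i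
    rwa [← Subtype.ext h]
  have h1 := N.subtype.map_formula (φ.ex) (fun i => (⟨v i, hv' i⟩ : N))
  have h2 : φ.ex.Realize (fun i => (⟨v i, hv' i⟩ : N)) default := by
    rw [← Formula.Realize, ← h1, Formula.Realize, BoundedFormula.realize_ex]
    exact ⟨b, hb⟩
  rw [BoundedFormula.realize_ex] at h2
  obtain ⟨c, hc⟩ := h2
  refine ⟨c, ⟨c, c.2, rfl⟩, ?_⟩
  have h3 := N.subtype.map_boundedFormula φ (fun i => (⟨v i, hv' i⟩ : N)) (Fin.snoc default c)
  rw [← h3] at hc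
  convert! hc using 1

theorem IsElementarySubmodel.subset {M A : Set ZFSet.{0}} (hM : IsElementarySubmodel M A) :
    M ⊆ A := by
  obtain ⟨N, rfl⟩ := hM
  rintro _ ⟨a, -, rfl⟩
  exact a.2

/-- The atomic formula `s ∈ t`. -/
def memFormula {α : Type} {n : ℕ} (s t : setLanguage.Term (α ⊕ Fin n)) :
    setLanguage.BoundedFormula α n :=
  Relations.boundedFormula₂ (L := setLanguage) MemRel.mem s t

theorem realize_memFormula {α : Type} {n : ℕ} {A : Set ZFSet.{0}}
    (s t : setLanguage.Term (α ⊕ Fin n)) (v : α → A) (xs : Fin n → A) :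
    (memFormula s t).Realize v xs ↔
      (s.realize (Sum.elim v xs) : A).1 ∈ (t.realize (Sum.elim v xs) : A).1 :=
  BoundedFormula.realize_rel₂

section Witnesses

variable {M : Set ZFSet.{0}} {θ : Cardinal.{0}}

theorem IsElementarySubmodel.exists_mem_mem (hM : IsElementarySubmodel M (HSet θ))
    {a b y : ZFSet.{0}} (ha : a ∈ M) (hb : b ∈ M)
    (hya : y ∈ a) (hyb : y ∈ b) : ∃ c ∈ M, c ∈ a ∧ c ∈ b := by
  obtain ⟨c, hc, h⟩ := hM.exists_realize (n := 2)
    (memFormula (&0) (Term.var (Sum.inl 0)) ⊓ memFormula (&0) (Term.var (Sum.inl 1)))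
    ![⟨a, hM.subset ha⟩, ⟨b, hM.subset hb⟩] (by simp [Fin.forall_fin_two, ha, hb])
    ⟨y, mem_HSet_of_mem (hM.subset ha) hya⟩ (by
      simp [realize_memFormula, Fin.snoc, hya, hyb])
  simp only [BoundedFormula.realize_inf, realize_memFormula] at h
  exact ⟨c, hc, by simpa [Fin.snoc] using h⟩

theorem IsElementarySubmodel.exists_mem_ne (hM : IsElementarySubmodel M (HSet θ))
    {a b y : ZFSet.{0}} (ha : a ∈ M) (hb : b ∈ M)
    (hya : y ∈ a) (hyb : y ≠ b) : ∃ c ∈ M, c ∈ a ∧ c ≠ b := by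
  obtain ⟨c, hc, h⟩ := hM.exists_realize (n := 2)
    (memFormula (&0) (Term.var (Sum.inl 0)) ⊓ ((&0).bdEqual (Term.var (Sum.inl 1))).not)
    ![⟨a, hM.subset ha⟩, ⟨b, hM.subset hb⟩] (by simp [Fin.forall_fin_two, ha, hb])
    ⟨y, mem_HSet_of_mem (hM.subset ha) hya⟩ (by
      simp [realize_memFormula, Fin.snoc, hya, hyb])
  simp only [BoundedFormula.realize_inf, realize_memFormula] at h
  exact ⟨c, hc, by simpa [Fin.snoc, Subtype.ext_iff] using h⟩

theorem IsElementarySubmodel.exists_mem_of_mem (hM : IsElementarySubmodel M (HSet θ))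
    {a b y : ZFSet.{0}} (ha : a ∈ M) (hb : b ∈ M)
    (hya : y ∈ a) (hyb : b ∈ y) : ∃ c ∈ M, c ∈ a ∧ b ∈ c := by
  obtain ⟨c, hc, h⟩ := hM.exists_realize (n := 2)
    (memFormula (&0) (Term.var (Sum.inl 0)) ⊓ memFormula (Term.var (Sum.inl 1)) (&0))
    ![⟨a, hM.subset ha⟩, ⟨b, hM.subset hb⟩] (by simp [Fin.forall_fin_two, ha, hb])
    ⟨y, mem_HSet_of_mem (hM.subset ha) hya⟩ (by
      simp [realize_memFormula, Fin.snoc, hya, hyb])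
  simp only [BoundedFormula.realize_inf, realize_memFormula] at h
  exact ⟨c, hc, by simpa [Fin.snoc] using h⟩

theorem IsElementarySubmodel.singleton_mem (hM : IsElementarySubmodel M (HSet θ))
    {a : ZFSet.{0}} (ha : a ∈ M) (h : {a} ∈ HSet θ) :
    {a} ∈ M := by
  obtain ⟨c, hc, h⟩ := hM.exists_realize (n := 1)
    ((memFormula (&1) (&0)).iff ((&1).bdEqual (Term.var (Sum.inl 0)))).all
    ![⟨a, hM.subset ha⟩] (by simp [ha])
    ⟨{a}, h⟩ (by
      simp [realize_memFormula, BoundedFormula.realize_all, BoundedFormula.realize_iff, Fin.snoc,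
        Subtype.ext_iff])
  simp only [BoundedFormula.realize_all, BoundedFormula.realize_iff, realize_memFormula] at h
  have key : (c : ZFSet) = {a} := by
    ext z
    rw [ZFSet.mem_singleton]
    constructor
    · intro hz
      simpa [Fin.snoc, Subtype.ext_iff, hz] using h ⟨z, mem_HSet_of_mem c.2 hz⟩
    · rintro rfl
      simpa [Fin.snoc, Subtype.ext_iff] using h ⟨z, hM.subset ha⟩
  rwa [← key]

theorem IsElementarySubmodel.mem_of_pair_mem (hM : IsElementarySubmodel M (HSet θ))
    {a b : ZFSet.{0}} (h : ({a, b} : ZFSet) ∈ M) :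
    a ∈ M ∧ b ∈ M := by
  have key : ∀ a b : ZFSet.{0}, ({a, b} : ZFSet) ∈ M → a ∈ M → b ∈ M := by
    intro a b h ha
    by_cases hab : b = a
    · rwa [hab]
    · obtain ⟨c, hc, hc1, hc2⟩ := hM.exists_mem_ne h ha (y := b) (by simp) hab
      rcases ZFSet.mem_pair.1 hc1 with rfl | rfl
      · exact absurd rfl hc2
      · exact hc
  obtain ⟨c, hc, hc1, -⟩ := hM.exists_mem_mem h h (y := a) (by simp) (by simp)
  rcases ZFSet.mem_pair.1 hc1 with rfl | rfl
  · exact ⟨hc, key _ _ h hc⟩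
  · exact ⟨key _ _ (by
      rwa [show ({c, a} : ZFSet.{0}) = {a, c} from ZFSet.ext (by simp [or_comm])]) hc, hc⟩

/-- An elementary submodel is closed under every function that belongs to it: if `g` is a set of
ordered pairs with `⟨a, b⟩ ∈ g` for exactly one `b`, then `g, a ∈ M` implies `b ∈ M`. -/
theorem IsElementarySubmodel.apply_mem (hM : IsElementarySubmodel M (HSet θ))
    {g a b : ZFSet.{0}} (hg : g ∈ M) (ha : a ∈ M)
    (hg_pair : ∀ p ∈ g, ∃ a' b', p = ZFSet.pair a' b') (hab : ZFSet.pair a b ∈ g)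
    (huniq : ∀ b', ZFSet.pair a b' ∈ g → b' = b) : b ∈ M := by
  have hs : ({a} : ZFSet) ∈ ZFSet.pair a b := by simp [ZFSet.pair]
  have hp : ZFSet.pair a b ∈ HSet θ := mem_HSet_of_mem (hM.subset hg) hab
  obtain ⟨p, hpM, hpg, hap⟩ := hM.exists_mem_of_mem hg
    (hM.singleton_mem ha (mem_HSet_of_mem hp hs)) hab hs
  obtain ⟨a', b', rfl⟩ := hg_pair p hpg
  have haa : a = a' := by
    rcases ZFSet.mem_pair.1 hap with h | h
    · exact ZFSet.singleton_injective h
    · have : a' ∈ ({a} : ZFSet) := by rw [h]; simp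
      exact (ZFSet.mem_singleton.1 this).symm
  subst haa
  obtain rfl := huniq b' hpg
  exact (hM.mem_of_pair_mem (hM.mem_of_pair_mem hpM).2).2

end Witnesses

end Formulas

/-! ### Coding functions on the countable ordinals by a single set -/

/-- A set coding the countable ordinal `γ`. The rank is shifted by `2` so that no code is a
singleton. -/
noncomputable def ordCode (γ : Omega1) : ZFSet.{0} := ZFSet.vonNeumann (γ.1 + 2)

theorem ordCode_injective : Function.Injective ordCode := by
  intro a b h
  have h1 := ZFSet.vonNeumann_injective h
  exact Subtype.ext ((Ordinal.add_right_cancel 2).1 (by exact_mod_cast h1))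

theorem ordCode_ne_singleton (γ : Omega1) (x : ZFSet.{0}) : ordCode γ ≠ {x} := by
  intro h
  have h2 : (0 : Ordinal) < γ.1 + 2 := by
    exact lt_of_lt_of_le (by norm_num) (le_add_self (a := (2 : Ordinal)))
  have h3 : (1 : Ordinal) < γ.1 + 2 := by
    exact lt_of_lt_of_le (by norm_num) (le_add_self (a := (2 : Ordinal)))
  have h0 : ZFSet.vonNeumann 0 ∈ ordCode γ := ZFSet.vonNeumann_mem_of_lt h2
  have h1 : ZFSet.vonNeumann 1 ∈ ordCode γ := ZFSet.vonNeumann_mem_of_lt h3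
  rw [h, ZFSet.mem_singleton] at h0 h1
  exact zero_ne_one (ZFSet.vonNeumann_injective (h0.trans h1.symm))

/-- The `n`-fold singleton of the code of `γ`, which serves as a code of the pair `(n, γ)`. -/
noncomputable def iterCode : ℕ → Omega1 → ZFSet.{0}
  | 0, γ => ordCode γ
  | n + 1, γ => {iterCode n γ}

theorem iterCode_inj : ∀ {n m : ℕ} {γ δ : Omega1}, iterCode n γ = iterCode m δ → n = m ∧ γ = δ
  | 0, 0, _, _, h => ⟨rfl, ordCode_injective h⟩
  | 0, _ + 1, _, _, h => absurd h (ordCode_ne_singleton _ _)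
  | _ + 1, 0, _, _, h => absurd h.symm (ordCode_ne_singleton _ _)
  | n + 1, m + 1, _, _, h => by
    obtain ⟨rfl, rfl⟩ := iterCode_inj (ZFSet.singleton_injective h)
    exact ⟨rfl, rfl⟩

/-- Countably many functions on `ω₁` can be coded by one set `x`, so that every elementary submodel
containing `x` is closed under all of them. The coding uses that submodels are closed under
singletons, which makes the natural numbers available as iterates. -/
theorem exists_code_closed (F : ℕ → Omega1 → ZFSet.{0}) : ∃ x : ZFSet.{0},
    ∀ (θ : Cardinal.{0}) (M : Set ZFSet.{0}), IsElementarySubmodel M (HSet θ) → x ∈ M →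
      ∀ γ, ordCode γ ∈ M → ∀ n, F n γ ∈ M := by
  let g : ℕ × Omega1 → ZFSet.{0} := fun p => ZFSet.pair (iterCode p.1 p.2) (F p.1 p.2)
  refine ⟨ZFSet.range g, fun θ M hM hx γ hγ n => ?_⟩
  have hg : ∀ n, ZFSet.pair (iterCode n γ) (F n γ) ∈ ZFSet.range g := fun n =>
    ZFSet.mem_range_self (f := g) (n, γ)
  have hcode : ∀ n, iterCode n γ ∈ M := by
    intro n
    induction n with
    | zero => exact hγ
    | succ n ih =>
      refine hM.singleton_mem ih (mem_HSet_of_mem (mem_HSet_of_mem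
        (mem_HSet_of_mem (hM.subset hx) (hg (n + 1))) (y := {iterCode (n + 1) γ}) ?_) ?_)
      · simp [ZFSet.pair]
      · simp [iterCode]
  refine hM.apply_mem hx (hcode n) ?_ (hg n) ?_
  · intro p hp
    obtain ⟨q, rfl⟩ := ZFSet.mem_range.1 hp
    exact ⟨_, _, rfl⟩
  · intro b' hb'
    obtain ⟨⟨m, δ⟩, h⟩ := ZFSet.mem_range.1 hb'
    obtain ⟨h1, h2⟩ := ZFSet.pair_injective h
    obtain ⟨rfl, rfl⟩ := iterCode_inj h1
    exact h2.symm

/-! ### A combinatorial form of `PFA(ω₁)` -/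

/-- The forcing poset whose conditions are the values of an injective coding `c` of the partial
order `Q` by sets. -/
noncomputable def ForcingPoset.ofCoding {Q : Type 1} [PartialOrder Q] [Small.{0} Q]
    (c : Q → ZFSet.{0}) : ForcingPoset where
  carrier := ZFSet.range c
  order := PartialOrder.lift (fun p => Classical.choose (ZFSet.mem_range.1 p.2)) (by
    intro p q h
    apply Subtype.ext
    rw [← Classical.choose_spec (ZFSet.mem_range.1 p.2),
      ← Classical.choose_spec (ZFSet.mem_range.1 q.2)]
    exact congrArg c h)

section Coding

variable {Q : Type 1} [PartialOrder Q] [Small.{0} Q] {c : Q → ZFSet.{0}}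

/-- The condition coding `q`. -/
noncomputable def ForcingPoset.condOf (c : Q → ZFSet.{0}) (q : Q) :
    (ForcingPoset.ofCoding c).Cond :=
  ⟨c q, ZFSet.mem_range_self q⟩

theorem ForcingPoset.condOf_surjective (p : (ForcingPoset.ofCoding c).Cond) :
    ∃ q, p = ForcingPoset.condOf c q := by
  obtain ⟨q, hq⟩ := ZFSet.mem_range.1 p.2
  exact ⟨q, Subtype.ext hq.symm⟩

theorem ForcingPoset.condOf_le (hc : Function.Injective c) {p q : Q} :
    ForcingPoset.condOf c p ≤ ForcingPoset.condOf c q ↔ p ≤ q := by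
  have h : ∀ q : Q, Classical.choose (ZFSet.mem_range.1 (ForcingPoset.condOf c q).2) = q :=
    fun q => hc (Classical.choose_spec (ZFSet.mem_range.1 (ForcingPoset.condOf c q).2))
  change Classical.choose (ZFSet.mem_range.1 (ForcingPoset.condOf c p).2) ≤
    Classical.choose (ZFSet.mem_range.1 (ForcingPoset.condOf c q).2) ↔ _
  rw [h, h]

end Coding

/-- A form of `PFA(ω₁)` in which no submodels occur. A partial order `Q` of size `ℵ₁` is coded
injectively by countable ordinals; `B` assigns to each ordinal countably many ordinals, and `X` is
a family of `ω₁` many subsets of `Q`. Suppose that for every countable `Δ` closed under `B` (the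
trace of a submodel) each condition coded in `Δ` has an extension `q` such that every `r ≤ q` lies
in some `X γ`, `γ ∈ Δ`, all of whose members coded in `Δ` are compatible with `r`. Then there are
directed subsets of `Q` that meet any `ω₁` many given dense sets. -/
theorem PFAOmega1.exists_filter (hPFA : PFAOmega1) {Q : Type 1} [PartialOrder Q] (hQ : #Q = ℵ₁)
    (e : Q → Omega1) (he : Function.Injective e) (B : Omega1 → Set Omega1)
    (hB : ∀ γ, (B γ).Countable) (X : Omega1 → Set Q)
    (hX : ∀ Δ : Set Omega1, Δ.Countable → (∀ γ ∈ Δ, B γ ⊆ Δ) → ∀ p, e p ∈ Δ →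
      ∃ q ≤ p, ∀ r ≤ q, ∃ γ ∈ Δ, r ∈ X γ ∧ ∀ r' ∈ X γ, e r' ∈ Δ → ∃ s, s ≤ r' ∧ s ≤ r)
    (D : Omega1 → Set Q) (hD : ∀ α p, ∃ d ∈ D α, d ≤ p) :
    ∃ G : Set Q, (∀ p ∈ G, ∀ q ∈ G, ∃ s, s ≤ p ∧ s ≤ q) ∧ ∀ α, ∃ p ∈ G, p ∈ D α := by
  have : Small.{0} Q := small_of_injective he
  let c : Q → ZFSet.{0} := fun q => ordCode (e q)
  have hc : Function.Injective c := ordCode_injective.comp he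
  have henum : ∀ γ, ∃ f : ℕ → Omega1, Set.range f = insert γ (B γ) := fun γ =>
    ((hB γ).insert γ).exists_eq_range (Set.insert_nonempty _ _) |>.imp fun _ h => h.symm
  choose enum henum using henum
  -- `F 0` is the family `X`, and `F (n + 1)` lists the `n`-th element of `B γ`
  let F : ℕ → Omega1 → ZFSet.{0} := fun n γ => match n with
    | 0 => ZFSet.range fun q : X γ => c q
    | n + 1 => ordCode (enum γ n)
  obtain ⟨x, hx⟩ := exists_code_closed F
  obtain ⟨θ₀, hθ₀⟩ := exists_forall_mem_HSet x
  let P := ForcingPoset.ofCoding c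
  have hproper : P.IsProper := by
    refine ⟨θ₀, fun θ hθ _ => ⟨x, hθ₀ θ hθ, fun M hMc hM hxM p hp => ?_⟩⟩
    let Δ : Set Omega1 := {γ | ordCode γ ∈ M}
    have hF : ∀ γ ∈ Δ, ∀ n, F n γ ∈ M := fun γ hγ n => hx θ M hM hxM γ hγ n
    obtain ⟨p, rfl⟩ := ForcingPoset.condOf_surjective p
    obtain ⟨q, hqp, hq⟩ := hX Δ (hMc.preimage ordCode_injective) (fun γ hγ β hβ => by
      obtain ⟨n, rfl⟩ : β ∈ Set.range (enum γ) := by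
        rw [henum]
        exact Set.mem_insert_of_mem _ hβ
      exact hF γ hγ (n + 1)) p hp
    refine ⟨ForcingPoset.condOf c q, (ForcingPoset.condOf_le hc).2 hqp, ?_⟩
    intro E hE _ hdense r hr
    obtain ⟨d, hdE, hdr⟩ := hdense r
    obtain ⟨r₀, rfl⟩ := ForcingPoset.condOf_surjective r
    obtain ⟨d₀, rfl⟩ := ForcingPoset.condOf_surjective d
    have hd0 := (ForcingPoset.condOf_le hc).1 hdr
    obtain ⟨γ, hγ, hdγ, hcompat⟩ := hq d₀ (hd0.trans ((ForcingPoset.condOf_le hc).1 hr))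
    have hXγ : (ZFSet.range fun q : X γ => c q) ∈ M := hF γ hγ 0
    -- elementarity: the members `E` and `X γ` of `M` meet, so they meet inside `M`
    obtain ⟨y, hyM, hyE, hyX⟩ := hM.exists_mem_mem hE hXγ (y := c d₀) hdE
      (ZFSet.mem_range.2 ⟨⟨d₀, hdγ⟩, rfl⟩)
    obtain ⟨⟨r', hr'⟩, rfl⟩ := ZFSet.mem_range.1 hyX
    obtain ⟨s, hs1, hs2⟩ := hcompat r' hr' hyM
    exact ⟨ForcingPoset.condOf c r', hyE, hyM, ForcingPoset.condOf c s,
      (ForcingPoset.condOf_le hc).2 hs1, (ForcingPoset.condOf_le hc).2 (hs2.trans hd0)⟩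
  have hcard : P.carrier.card = ℵ₁ := by
    rw [← Cardinal.lift_inj.{0, 1}, ← ZFSet.cardinalMk_coe_sort]
    have h1 : #(P.carrier) = #(Set.range c) := by
      rw [← ZFSet.coe_range]
      rfl
    rw [h1, Cardinal.mk_range_eq c hc, hQ]
    simp
  obtain ⟨G, hG⟩ := hPFA P hproper hcard (fun α => {p | ∃ q ∈ D α, p = ForcingPoset.condOf c q})
    (by
      intro α p
      obtain ⟨p, rfl⟩ := ForcingPoset.condOf_surjective p
      obtain ⟨d, hd, hdp⟩ := hD α p
      exact ⟨_, ⟨d, hd, rfl⟩, (ForcingPoset.condOf_le hc).2 hdp⟩)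
  refine ⟨{q | ForcingPoset.condOf c q ∈ G}, ?_, ?_⟩
  · intro p hp q hq
    obtain ⟨s, -, hs1, hs2⟩ := G.directed _ hp _ hq
    obtain ⟨s, rfl⟩ := ForcingPoset.condOf_surjective s
    exact ⟨s, (ForcingPoset.condOf_le hc).1 hs1, (ForcingPoset.condOf_le hc).1 hs2⟩
  · intro α
    obtain ⟨p, hp, q, hq, rfl⟩ := hG α
    exact ⟨q, hp, hq⟩

/-! ### Separating overlapping intervals by a colouring -/

theorem mk_Omega1 : #Omega1 = ℵ₁ := by
  rw [Cardinal.mk_Iio_ordinal, Ordinal.card_omega, Cardinal.lift_aleph, Ordinal.lift_one]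

theorem not_countable_univ_Omega1 : ¬ (Set.univ : Set Omega1).Countable := by
  rw [← Cardinal.le_aleph0_iff_set_countable, Cardinal.mk_univ, mk_Omega1]
  exact not_le.2 Cardinal.aleph0_lt_aleph_one

theorem countable_Iio_Omega1 (γ : Omega1) : (Set.Iio γ).Countable := by
  have h : (Set.Iio γ.1).Countable := by
    rw [← Cardinal.le_aleph0_iff_set_countable, Cardinal.mk_Iio_ordinal,
      Cardinal.lift_le_aleph0, ← Order.lt_succ_iff, Cardinal.succ_aleph0, ← Cardinal.lt_ord,
      Cardinal.ord_aleph]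
    exact γ.2
  exact h.preimage Subtype.val_injective

theorem countable_Iic_Omega1 (γ : Omega1) : (Set.Iic γ).Countable := by
  rw [← Set.Iio_insert]
  exact (countable_Iio_Omega1 γ).insert γ

theorem countable_finset_subset {α : Type*} {s : Set α} (hs : s.Countable) :
    {t : Finset α | (t : Set α) ⊆ s}.Countable := by
  refine ((Set.countable_ofPred_finite_subset hs).preimage
    (f := fun t : Finset α => (t : Set α)) Finset.coe_injective).mono fun t ht => ?_
  exact ⟨t.finite_toSet, ht⟩

/-- A finite condition of the forcing that colours the points of `S`. The pair `(α, m) ∈ col`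
promises colour `m` to `α`; a point `δ ∈ pts` promises that no interval `[lo α m, hi α m]` of a
coloured `α` is split by `δ`. Overlapping intervals with the same colour have the same right
endpoint. -/
@[ext]
structure IntervalCond (S : Set Omega1) (lo hi : Omega1 → ℕ → Omega1) : Type 1 where
  col : Finset (Omega1 × ℕ)
  pts : Finset Omega1
  mem : ∀ x ∈ col, x.1 ∈ S
  not_split : ∀ x ∈ col, ∀ δ ∈ pts, hi x.1 x.2 < δ ∨ δ ≤ lo x.1 x.2
  hi_eq : ∀ x ∈ col, ∀ y ∈ col, x.2 = y.2 → lo x.1 x.2 ≤ hi y.1 y.2 → lo y.1 y.2 ≤ hi x.1 x.2 →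
    hi x.1 x.2 = hi y.1 y.2

namespace IntervalCond

variable {S : Set Omega1} {lo hi : Omega1 → ℕ → Omega1}

/-- Conditions are ordered by reverse inclusion. -/
instance : PartialOrder (IntervalCond S lo hi) :=
  PartialOrder.lift (fun p => OrderDual.toDual (p.col, p.pts)) (by
    intro p q h
    have h' : (p.col, p.pts) = (q.col, q.pts) := h
    rw [Prod.mk.injEq] at h'
    exact IntervalCond.ext h'.1 h'.2)

theorem mk_eq : #(IntervalCond S lo hi) = ℵ₁ := by
  have hinf : Infinite Omega1 := by
    rw [Cardinal.infinite_iff, mk_Omega1]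
    exact Cardinal.aleph0_le_aleph 1
  apply le_antisymm
  · have h : #(IntervalCond S lo hi) ≤ #(Finset (Omega1 × ℕ) × Finset Omega1) :=
      Cardinal.mk_le_of_injective (f := fun p => (p.col, p.pts)) (by
        intro p q h
        rw [Prod.mk.injEq] at h
        exact IntervalCond.ext h.1 h.2)
    refine h.trans ?_
    simp [Cardinal.aleph0_le_aleph]
  · rw [← mk_Omega1]
    exact Cardinal.mk_le_of_injective
      (f := fun δ => (⟨∅, {δ}, by simp, by simp, by simp⟩ : IntervalCond S lo hi)) (by
        intro a b h
        simpa using congrArg IntervalCond.pts h)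

/-- Every point of `S` can be given a colour. -/
theorem exists_le_mem_col (hhi : ∀ α ∈ S, ∀ m, hi α m < α)
    (hlo : ∀ α ∈ S, ∀ γ < α, ∀ᶠ m in Filter.atTop, γ ≤ lo α m) (p : IntervalCond S lo hi)
    {α : Omega1} (hα : α ∈ S) : ∃ q ≤ p, ∃ m, (α, m) ∈ q.col := by
  have h1 : ∀ᶠ m in Filter.atTop, ∀ δ ∈ p.pts, δ < α → δ ≤ lo α m := by
    rw [Filter.eventually_all_finset]
    intro δ _
    by_cases h : δ < α
    · exact (hlo α hα δ h).mono fun m hm _ => hm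
    · exact Filter.Eventually.of_forall fun m h' => absurd h' h
  have h2 : ∀ᶠ m in Filter.atTop, m ∉ p.col.image Prod.snd := by
    rw [← Nat.cofinite_eq_atTop]
    exact (p.col.image Prod.snd).finite_toSet.eventually_cofinite_notMem
  obtain ⟨m, hm1, hm2⟩ := (h1.and h2).exists
  have hfresh : ∀ x ∈ p.col, x.2 ≠ m := fun x hx h => hm2 (Finset.mem_image.2 ⟨x, hx, h⟩)
  refine ⟨⟨insert (α, m) p.col, p.pts, ?_, ?_, ?_⟩, ⟨Finset.subset_insert _ _, subset_rfl⟩, m,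
    Finset.mem_insert_self _ _⟩
  · intro x hx
    rcases Finset.mem_insert.1 hx with rfl | hx
    · exact hα
    · exact p.mem x hx
  · intro x hx δ hδ
    rcases Finset.mem_insert.1 hx with rfl | hx
    · rcases lt_or_ge δ α with h | h
      · exact Or.inr (hm1 δ hδ h)
      · exact Or.inl ((hhi α hα m).trans_le h)
    · exact p.not_split x hx δ hδ
  · intro x hx y hy hxy h3 h4
    rcases Finset.mem_insert.1 hx with rfl | hx <;> rcases Finset.mem_insert.1 hy with rfl | hy
    · rfl
    · exact absurd hxy.symm (hfresh y hy)
    · exact absurd hxy (hfresh x hx)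
    · exact p.hi_eq x hx y hy hxy h3 h4

/-- Finite information on a condition: a finite part of it, a bound `ξ`, and a finite list of
coloured intervals. -/
abbrev Info : Type 1 :=
  (Finset (Omega1 × ℕ) × Finset Omega1) × Omega1 × Finset (ℕ × Omega1 × Omega1)

/-- The condition `r` extends the part recorded in `j`, has no further points below the bound, and
the interval of each further coloured point is one of those listed in `j` or lies above the
bound. -/
def Matches (j : Info) (r : IntervalCond S lo hi) : Prop :=
  j.1.1 ⊆ r.col ∧ j.1.2 ⊆ r.pts ∧ (∀ δ ∈ r.pts, δ < j.2.1 → δ ∈ j.1.2) ∧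
    ∀ x ∈ r.col, x ∈ j.1.1 ∨ (x.2, lo x.1 x.2, hi x.1 x.2) ∈ j.2.2 ∨ j.2.1 ≤ lo x.1 x.2

/-- The pieces of finite information all of whose ordinals are at most `γ`. -/
def infoBelow (γ : Omega1) : Set Info :=
  ({t : Finset (Omega1 × ℕ) | (t : Set (Omega1 × ℕ)) ⊆ Set.Iic γ ×ˢ Set.univ} ×ˢ
    {t : Finset Omega1 | (t : Set Omega1) ⊆ Set.Iic γ}) ×ˢ
    Set.Iic γ ×ˢ
      {t : Finset (ℕ × Omega1 × Omega1) | (t : Set (ℕ × Omega1 × Omega1)) ⊆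
         Set.univ ×ˢ Set.Iic γ ×ˢ Set.Iic γ}

theorem countable_infoBelow (γ : Omega1) : (infoBelow γ).Countable := by
  have h := countable_Iic_Omega1 γ
  exact ((countable_finset_subset (h.prod (Set.to_countable Set.univ))).prod
    (countable_finset_subset h)).prod (h.prod (countable_finset_subset
      ((Set.to_countable Set.univ).prod (h.prod h))))

theorem mk_Info : #Info ≤ ℵ₁ := by
  have hinf : Infinite Omega1 := by
    rw [Cardinal.infinite_iff, mk_Omega1]
    exact Cardinal.aleph0_le_aleph 1
  simp [Cardinal.aleph0_le_aleph]

/-- The finite information about `r` that is visible below `δ ∈ r.pts`: any condition living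
below `δ` and matching it is compatible with `r`. -/
theorem exists_info (hlohi : ∀ α ∈ S, ∀ m, lo α m ≤ hi α m) (hhi : ∀ α ∈ S, ∀ m, hi α m < α)
    {δ : Omega1} (hδ0 : (Set.Iio δ).Nonempty) (hδ : ∀ γ < δ, Order.succ γ < δ)
    (r : IntervalCond S lo hi) (hr : δ ∈ r.pts) :
    ∃ γ < δ, ∃ j ∈ infoBelow γ, Matches j r ∧ ∀ r' : IntervalCond S lo hi, Matches j r' →
      (∀ x ∈ r'.col, x.1 < δ) → (∀ β ∈ r'.pts, β < δ) → ∃ s, s ≤ r' ∧ s ≤ r := by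
  classical
  obtain ⟨γ₀, hγ₀⟩ := hδ0
  let f₀ := r.col.filter fun x => x.1 < δ
  let N₀ := r.pts.filter fun β => β < δ
  let A := (r.col.filter fun x => hi x.1 x.2 < δ).image fun x => (x.2, lo x.1 x.2, hi x.1 x.2)
  let T := insert γ₀ (f₀.image Prod.fst ∪ N₀ ∪ A.image fun a => a.2.2)
  have hT : ∀ β ∈ T, β < δ := by
    intro β hβ
    simp only [T, f₀, N₀, A, Finset.mem_insert, Finset.mem_union, Finset.mem_image,
      Finset.mem_filter] at hβ
    rcases hβ with rfl | (⟨x, hx, rfl⟩ | hβ) | ⟨_, ⟨x, hx, rfl⟩, rfl⟩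
    · exact hγ₀
    · exact hx.2
    · exact hβ.2
    · exact hx.2
  let μ := T.max' (Finset.insert_nonempty _ _)
  have hμ : μ < δ := hT _ (Finset.max'_mem _ _)
  have hle : ∀ β ∈ T, β ≤ μ := fun β hβ => Finset.le_max' _ _ hβ
  have hμξ : μ < Order.succ μ := Order.lt_succ_of_not_isMax (not_isMax_of_lt hμ)
  have hf₀ : ∀ x ∈ f₀, x.1 ≤ μ := fun x hx => hle _ (by
    simp only [T, Finset.mem_insert, Finset.mem_union, Finset.mem_image]
    exact Or.inr (Or.inl (Or.inl ⟨x, hx, rfl⟩)))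
  have hN₀ : ∀ β ∈ N₀, β ≤ μ := fun x hx => hle _ (by
    simp only [T, Finset.mem_insert, Finset.mem_union, Finset.mem_image]
    exact Or.inr (Or.inl (Or.inr hx)))
  have hA : ∀ a ∈ A, a.2.2 ≤ μ := fun x hx => hle _ (by
    simp only [T, Finset.mem_insert, Finset.mem_union, Finset.mem_image]
    exact Or.inr (Or.inr ⟨x, hx, rfl⟩))
  have hAlo : ∀ a ∈ A, a.2.1 ≤ μ := by
    intro a ha
    refine le_trans ?_ (hA a ha)
    obtain ⟨x, hx, rfl⟩ := Finset.mem_image.1 ha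
    exact hlohi _ (r.mem x (Finset.mem_filter.1 hx).1) _
  have memA : ∀ x ∈ r.col, hi x.1 x.2 < δ → (x.2, lo x.1 x.2, hi x.1 x.2) ∈ A := fun x hx h =>
    Finset.mem_image.2 ⟨x, Finset.mem_filter.2 ⟨hx, h⟩, rfl⟩
  refine ⟨Order.succ μ, hδ μ hμ, ((f₀, N₀), Order.succ μ, A), ?_, ?_, ?_⟩
  · refine ⟨⟨fun x hx => ⟨(hf₀ x hx).trans hμξ.le, trivial⟩, fun x hx => (hN₀ x hx).trans hμξ.le⟩,
      le_refl (Order.succ μ), fun x hx => ⟨trivial, (hAlo x hx).trans hμξ.le,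
        (hA x hx).trans hμξ.le⟩⟩
  · refine ⟨Finset.filter_subset _ _, Finset.filter_subset _ _, fun β hβ hβξ => ?_, fun x hx => ?_⟩
    · exact Finset.mem_filter.2 ⟨hβ, hβξ.trans (hδ μ hμ)⟩
    · rcases r.not_split x hx δ hr with h | h
      · exact Or.inr (Or.inl (memA x hx h))
      · exact Or.inr (Or.inr ((hδ μ hμ).le.trans h))
  · rintro r' ⟨hf, hN, hpts, hcol⟩ hr'col hr'pts
    have hi_lt : ∀ y ∈ r'.col, hi y.1 y.2 < δ := fun y hy =>
      (hhi _ (r'.mem y hy) _).trans (hr'col y hy)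
    have key : ∀ x ∈ r.col, ∀ y ∈ r'.col, x.2 = y.2 → lo x.1 x.2 ≤ hi y.1 y.2 →
        lo y.1 y.2 ≤ hi x.1 x.2 → hi x.1 x.2 = hi y.1 y.2 := by
      intro x hx y hy hxy h1 h2
      rcases r.not_split x hx δ hr with h | h
      · rcases hcol y hy with h3 | h3 | h3
        · exact r.hi_eq x hx y (Finset.mem_filter.1 h3).1 hxy h1 h2
        · -- `y` imitates some `z` coloured by `r`, so the clause for `x` and `z` applies
          obtain ⟨z, hz, hzy⟩ := Finset.mem_image.1 h3
          simp only [Prod.mk.injEq] at hzy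
          obtain ⟨hz1, hz2, hz3⟩ := hzy
          rw [← hz3]
          exact r.hi_eq x hx z (Finset.mem_filter.1 hz).1 (hxy.trans hz1.symm) (hz3 ▸ h1)
            (hz2 ▸ h2)
        · exact absurd ((h3.trans h2).trans (hA _ (memA x hx h))) (not_le.2 hμξ)
      · exact absurd ((h.trans h1).trans_lt (hi_lt y hy)) (lt_irrefl δ)
    refine ⟨⟨r'.col ∪ r.col, r'.pts ∪ r.pts, ?_, ?_, ?_⟩,
      ⟨Finset.subset_union_left, Finset.subset_union_left⟩,
      ⟨Finset.subset_union_right, Finset.subset_union_right⟩⟩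
    · intro x hx
      rcases Finset.mem_union.1 hx with hx | hx
      · exact r'.mem x hx
      · exact r.mem x hx
    · intro x hx β hβ
      rcases Finset.mem_union.1 hx with hx | hx <;> rcases Finset.mem_union.1 hβ with hβ | hβ
      · exact r'.not_split x hx β hβ
      · rcases lt_or_ge β δ with h | h
        · exact r'.not_split x hx β (hN (Finset.mem_filter.2 ⟨hβ, h⟩))
        · exact Or.inl ((hi_lt x hx).trans_le h)
      · rcases lt_or_ge β (Order.succ μ) with h | h
        · exact r.not_split x hx β (Finset.mem_filter.1 (hpts β hβ h)).1
        · rcases r.not_split x hx δ hr with h1 | h1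
          · exact Or.inl (((hA _ (memA x hx h1)).trans_lt hμξ).trans_le h)
          · exact Or.inr ((hr'pts β hβ).le.trans h1)
      · exact r.not_split x hx β hβ
    · intro x hx y hy hxy h1 h2
      rcases Finset.mem_union.1 hx with hx | hx <;> rcases Finset.mem_union.1 hy with hy | hy
      · exact r'.hi_eq x hx y hy hxy h1 h2
      · exact (key y hy x hx hxy.symm h2 h1).symm
      · exact key x hx y hy hxy h1 h2
      · exact r.hi_eq x hx y hy hxy h1 h2

end IntervalCond

/-- A countable lower set of countable ordinals is a proper initial segment. -/
theorem exists_eq_Iio {Δ : Set Omega1} (hc : Δ.Countable) (hΔ : ∀ γ ∈ Δ, Set.Iic γ ⊆ Δ) :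
    ∃ δ, Δ = Set.Iio δ := by
  have hne : Δᶜ.Nonempty := by
    rw [Set.nonempty_compl]
    rintro rfl
    exact not_countable_univ_Omega1 hc
  refine ⟨wellFounded_lt.min Δᶜ hne, ?_⟩
  ext γ
  constructor
  · intro hγ
    by_contra h
    exact wellFounded_lt.min_mem Δᶜ hne
      (hΔ γ hγ (Set.mem_Iic.2 (not_lt.1 fun h1 => h (Set.mem_Iio.2 h1))))
  · intro hγ
    by_contra h
    exact wellFounded_lt.not_lt_min Δᶜ h hγ

/-- Under `PFA(ω₁)`, if each `α ∈ S` carries intervals `[lo α m, hi α m]` below `α` that converge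
to `α`, then one can choose for each `α` one of its intervals, with index `f α`, in such a way that
chosen intervals with the same index can only overlap if they have the same right endpoint. -/
theorem PFAOmega1.exists_separating_coloring (hPFA : PFAOmega1) (S : Set Omega1)
    (lo hi : Omega1 → ℕ → Omega1) (hlohi : ∀ α ∈ S, ∀ m, lo α m ≤ hi α m)
    (hhi : ∀ α ∈ S, ∀ m, hi α m < α)
    (hlo : ∀ α ∈ S, ∀ γ < α, ∀ᶠ m in Filter.atTop, γ ≤ lo α m) :
    ∃ f : Omega1 → ℕ, ∀ α ∈ S, ∀ β ∈ S, f α = f β → lo α (f α) ≤ hi β (f β) →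
      lo β (f β) ≤ hi α (f α) → hi α (f α) = hi β (f β) := by
  classical
  have hQ : #(IntervalCond S lo hi) = ℵ₁ := IntervalCond.mk_eq
  obtain ⟨⟨e, he⟩⟩ : #(IntervalCond S lo hi) ≤ #Omega1 := by rw [hQ, mk_Omega1]
  obtain ⟨⟨c, hc⟩⟩ : #IntervalCond.Info ≤ #Omega1 := by
    rw [mk_Omega1]
    exact IntervalCond.mk_Info
  -- closure under `B` makes `Δ` a limit ordinal `δ`; conditions coded in `Δ` live below `δ`, and
  -- all finite information below `δ` is coded in `Δ`
  let B : Omega1 → Set Omega1 := fun γ => Set.Iic (Order.succ γ) ∪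
    {δ | ∃ q, e q = γ ∧ δ ∈ q.pts ∪ q.col.image Prod.fst} ∪ c '' IntervalCond.infoBelow γ
  have hB : ∀ γ, (B γ).Countable := by
    intro γ
    refine ((countable_Iic_Omega1 _).union ?_).union ((IntervalCond.countable_infoBelow γ).image c)
    by_cases h : ∃ q, e q = γ
    · obtain ⟨q, rfl⟩ := h
      refine (q.pts ∪ q.col.image Prod.fst).countable_toSet.mono ?_
      rintro δ ⟨q', hq', hδ⟩
      rwa [← he hq']
    · convert! Set.countable_empty
      ext δ
      simp only [Set.mem_ofPred_eq, Set.mem_empty_iff_false, iff_false]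
      rintro ⟨q, hq, -⟩
      exact h ⟨q, hq⟩
  obtain ⟨G, hG, hGD⟩ := hPFA.exists_filter hQ e he B hB
    (fun γ => {r | ∃ j, c j = γ ∧ IntervalCond.Matches j r}) (by
      intro Δ hΔ hΔB p hp
      have hIic : ∀ γ ∈ Δ, Set.Iic (Order.succ γ) ⊆ Δ := fun γ hγ β hβ =>
        hΔB γ hγ (Or.inl (Or.inl hβ))
      have hsupp : ∀ q, e q ∈ Δ → ∀ δ ∈ q.pts ∪ q.col.image Prod.fst, δ ∈ Δ := fun q hq δ hδ =>
        hΔB _ hq (Or.inl (Or.inr ⟨q, rfl, hδ⟩))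
      obtain ⟨δ, rfl⟩ := exists_eq_Iio hΔ fun γ hγ β hβ =>
        hIic γ hγ (le_trans hβ (Order.le_succ γ))
      have hcol : ∀ q, e q ∈ Set.Iio δ → ∀ x ∈ q.col, x.1 < δ := fun q hq x hx =>
        hsupp q hq _ (Finset.mem_union_right _ (Finset.mem_image_of_mem _ hx))
      refine ⟨⟨p.col, insert δ p.pts, p.mem, ?_, p.hi_eq⟩, ⟨subset_rfl, Finset.subset_insert _ _⟩,
        ?_⟩
      · intro x hx β hβ
        rcases Finset.mem_insert.1 hβ with rfl | hβ
        · exact Or.inl ((hhi _ (p.mem x hx) _).trans (hcol p hp x hx))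
        · exact p.not_split x hx β hβ
      · intro r hr
        obtain ⟨γ, hγ, j, hj, hjr, hcompat⟩ := IntervalCond.exists_info hlohi hhi ⟨e p, hp⟩
          (fun γ hγ => hIic γ hγ (le_refl (Order.succ γ))) r (hr.2 (Finset.mem_insert_self _ _))
        refine ⟨c j, hΔB γ hγ (Or.inr ⟨j, hj, rfl⟩), ⟨j, rfl, hjr⟩, ?_⟩
        rintro r' ⟨j', hj', hr'⟩ her'
        obtain rfl := hc hj'
        exact hcompat r' hr' (hcol r' her') fun β hβ =>
          hsupp r' her' β (Finset.mem_union_left _ hβ))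
    (fun α => {p | α ∈ S → ∃ m, (α, m) ∈ p.col}) (by
      intro α p
      by_cases hα : α ∈ S
      · obtain ⟨q, hq, hm⟩ := IntervalCond.exists_le_mem_col hhi hlo p hα
        exact ⟨q, fun _ => hm, hq⟩
      · exact ⟨p, fun h => absurd h hα, le_rfl⟩)
  have hex : ∀ α, ∃ m, α ∈ S → ∃ p ∈ G, (α, m) ∈ p.col := by
    intro α
    by_cases hα : α ∈ S
    · obtain ⟨p, hp, h⟩ := hGD α
      obtain ⟨m, hm⟩ := h hα
      exact ⟨m, fun _ => ⟨p, hp, hm⟩⟩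
    · exact ⟨0, fun h => absurd h hα⟩
  choose f hf using hex
  refine ⟨f, fun α hα β hβ hαβ h1 h2 => ?_⟩
  obtain ⟨p, hp, hαp⟩ := hf α hα
  obtain ⟨q, hq, hβq⟩ := hf β hβ
  obtain ⟨s, hsp, hsq⟩ := hG p hp q hq
  exact s.hi_eq _ (hsp.1 hαp) _ (hsq.1 hβq) hαβ h1 h2

/-! ### Enumerating the sets of a `C`-sequence -/

theorem isNth_range {X : Type*} [LinearOrder X] {g : ℕ → X} (hg : StrictMono g) (k : ℕ) (x : X) :
    IsNth (Set.range g) k x ↔ x = g k := by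
  have key : ∀ n, IsNth (Set.range g) k (g n) ↔ n = k := by
    intro n
    rw [← Set.image_univ, DisjointType.isNth_image hg]
    simp only [IsNth, Set.mem_univ, Set.univ_inter, true_and]
    rw [← Set.Finite.cast_ncard_eq (Set.finite_Iio n)]
    simp
  constructor
  · intro h
    obtain ⟨n, rfl⟩ := h.1
    rw [(key n).1 h]
  · rintro rfl
    exact (key k).2 rfl

theorem firstElems_range {X : Type*} [LinearOrder X] {g : ℕ → X} (hg : StrictMono g) (n : ℕ) :
    firstElems (Set.range g) n = g '' Set.Iio n := by
  ext x
  constructor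
  · rintro ⟨i, hi, h⟩
    exact ⟨i, hi, ((isNth_range hg i x).1 h).symm⟩
  · rintro ⟨i, hi, rfl⟩
    exact ⟨i, hi, (isNth_range hg i _).2 rfl⟩

theorem exists_strictMono_range_eq {s : Set Omega1} (hs : typeLT s = ω) :
    ∃ g : ℕ → Omega1, StrictMono g ∧ Set.range g = s := by
  have h : Ordinal.lift.{1} (typeLT ℕ) = Ordinal.lift.{0} (typeLT s) := by
    rw [hs]
    simp
  obtain ⟨φ⟩ := Ordinal.lift_type_eq.1 h
  refine ⟨fun n => (φ n).1, fun a b hab => φ.map_rel_iff.2 hab, ?_⟩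
  ext x
  constructor
  · rintro ⟨n, rfl⟩
    exact (φ n).2
  · intro hx
    obtain ⟨n, hn⟩ := φ.surjective ⟨x, hx⟩
    exact ⟨n, by simp [hn]⟩

/-- A `C`-sequence is given by strictly increasing sequences `g α` converging to `α`. -/
theorem IsCSequence.exists_enum {C : Omega1 → Set Omega1} (hC : IsCSequence C) :
    ∃ g : Omega1 → ℕ → Omega1, ∀ α, Order.IsSuccLimit α →
      StrictMono (g α) ∧ Set.range (g α) = C α ∧ (∀ n, g α n < α) ∧
        ∀ γ < α, ∀ᶠ n in Filter.atTop, γ ≤ g α n := by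
  have h : ∀ α, ∃ g : ℕ → Omega1, Order.IsSuccLimit α →
      StrictMono g ∧ Set.range g = C α ∧ (∀ n, g n < α) ∧
        ∀ γ < α, ∀ᶠ n in Filter.atTop, γ ≤ g n := by
    intro α
    by_cases hα : Order.IsSuccLimit α
    · obtain ⟨h1, h2, h3⟩ := hC α hα
      obtain ⟨g, hg, hr⟩ := exists_strictMono_range_eq h3
      refine ⟨g, fun _ => ⟨hg, hr, fun n => h1 _ (hr ▸ Set.mem_range_self n), fun γ hγ => ?_⟩⟩
      obtain ⟨δ, hδ, hγδ⟩ := h2 γ hγ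
      rw [← hr] at hδ
      obtain ⟨n, rfl⟩ := hδ
      exact Filter.eventually_atTop.2 ⟨n, fun m hm => hγδ.trans (hg.monotone hm)⟩
    · exact ⟨fun _ => α, fun h => absurd h hα⟩
  choose g hg using h
  exact ⟨g, hg⟩

/-! ### Depth and overlapping intervals -/

namespace DisjointType

theorem depth_lt_width {t : DisjointType} (h : 0 < t.depth) : t.depth < t.width := by
  have hne : {k | k < t.width ∧ ((∃ x, IsNth (t.positions 1) k x ∧ ∀ y ∈ t.positions 0, y < x) ∨
      (∃ x, IsNth (t.positions 0) k x ∧ ∀ y ∈ t.positions 1, y < x))}.Nonempty :=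
    Nat.nonempty_of_pos_sInf h
  exact (Nat.sInf_mem hne).1

theorem opposite_isTypeOf {t : DisjointType} {X : Type*} [LinearOrder X] {a b : Set X} :
    t.opposite.IsTypeOf a b ↔ t.IsTypeOf b a := by
  have h0 : t.opposite.positions 0 = t.positions 1 := by
    ext i
    change 1 - t.val i = 0 ↔ t.val i = 1
    generalize t.val i = c
    revert c
    decide
  have h1 : t.opposite.positions 1 = t.positions 0 := by
    ext i
    change 1 - t.val i = 1 ↔ t.val i = 0
    generalize t.val i = c
    revert c
    decide
  constructor
  · rintro ⟨e, he, ha, hb⟩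
    exact ⟨e, he, hb.trans (congrArg (Set.image e) h1), ha.trans (congrArg (Set.image e) h0)⟩
  · rintro ⟨e, he, hb, ha⟩
    exact ⟨e, he, ha.trans (congrArg (Set.image e) h0.symm),
      hb.trans (congrArg (Set.image e) h1.symm)⟩

theorem IsTypeOf.disjoint {t : DisjointType} {X : Type*} [LinearOrder X] {a b : Set X}
    (h : t.IsTypeOf a b) : Disjoint a b := by
  obtain ⟨e, he, rfl, rfl⟩ := h
  rw [Set.disjoint_image_iff he.injective, Set.disjoint_left]
  intro i h0 h1
  have h0' : t.val i = 0 := h0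
  have h1' : t.val i = 1 := h1
  rw [h0'] at h1'
  exact absurd h1' (by decide)

end DisjointType

theorem isNth_image_Iio {X : Type*} [LinearOrder X] {g : ℕ → X} (hg : StrictMono g) {k n : ℕ}
    (hk : k < n) : IsNth (g '' Set.Iio n) k (g k) := by
  rw [DisjointType.isNth_image hg]
  refine ⟨hk, ?_⟩
  rw [Set.inter_eq_right.2 (Set.Iio_subset_Iio hk.le),
    ← Set.Finite.cast_ncard_eq (Set.finite_Iio k)]
  simp

/-- If two `n`-element sets realize a type of depth `d > 0`, then the intervals spanned by their
elements number `d - 1` and `n - 1` overlap and have different right endpoints. -/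
theorem DisjointType.IsTypeOf.overlap {t : DisjointType} (hd : 0 < t.depth) {X : Type*}
    [LinearOrder X] {g g' : ℕ → X} (hg : StrictMono g) (hg' : StrictMono g')
    (h : t.IsTypeOf (g '' Set.Iio t.width) (g' '' Set.Iio t.width)) :
    g (t.depth - 1) ≤ g' (t.width - 1) ∧ g' (t.depth - 1) ≤ g (t.width - 1) ∧
      g (t.width - 1) ≠ g' (t.width - 1) := by
  have hlt := DisjointType.depth_lt_width hd
  have hdepth := t.depthOfPair_eq_depth h
  have hnot := Nat.notMem_of_lt_sInf (show t.depth - 1 < DisjointType.depthOfPair _ _ _ by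
    rw [hdepth]; omega)
  have hle : ∀ {u v : ℕ → X}, StrictMono v → (¬ ∃ x, IsNth (u '' Set.Iio t.width) (t.depth - 1) x ∧
      ∀ y ∈ v '' Set.Iio t.width, y < x) → StrictMono u →
      u (t.depth - 1) ≤ v (t.width - 1) := by
    intro u v hv h1 hu
    by_contra! h2
    refine h1 ⟨_, isNth_image_Iio hu (by omega), ?_⟩
    rintro _ ⟨i, hi, rfl⟩
    have hi' : i < t.width := hi
    exact (hv.monotone (by omega)).trans_lt h2
  refine ⟨hle hg' (fun h1 => hnot ⟨by omega, Or.inr h1⟩) hg,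
    hle hg (fun h1 => hnot ⟨by omega, Or.inl h1⟩) hg', fun heq => ?_⟩
  have hmem : t.width - 1 ∈ Set.Iio t.width := Set.mem_Iio.2 (by omega)
  exact Set.disjoint_left.1 h.disjoint ⟨_, hmem, rfl⟩ ⟨_, hmem, heq.symm⟩

theorem exists_strictMono_lt_depth {t : ℕ → DisjointType}
    (ht : (⨆ k, ((t k).depth : ℕ∞)) = ⊤) :
    ∃ κ : ℕ → ℕ, StrictMono κ ∧ ∀ m, m < (t (κ m)).depth := by
  refine Filter.extraction_forall_of_frequently (P := fun m k => m < (t k).depth)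
    fun m => Filter.frequently_atTop.2 fun N => ?_
  obtain ⟨k, hk⟩ := iSup_eq_top.1 ht ((m + ∑ i ∈ Finset.range N, (t i).depth : ℕ) : ℕ∞)
    (ENat.natCast_lt_top _)
  have hk' : m + ∑ i ∈ Finset.range N, (t i).depth < (t k).depth := by exact_mod_cast hk
  refine ⟨k, ?_, by omega⟩
  by_contra! hkN
  have := Finset.single_le_sum (f := fun i => (t i).depth) (fun _ _ => Nat.zero_le _)
    (Finset.mem_range.2 hkN)
  omega

/-- The guessing fails for the colouring `α ↦ κ (f α)`, where `κ` enumerates types of large depth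
and `f` separates the corresponding intervals. -/
theorem PFAOmega1.not_isGuessingSequence (hPFA : PFAOmega1) {t : ℕ → DisjointType}
    (ht : (⨆ k, ((t k).depth : ℕ∞)) = ⊤) (C : Omega1 → Set Omega1) :
    ¬ IsGuessingSequence C t := by
  rintro ⟨hC, hguess⟩
  obtain ⟨g, hg⟩ := hC.exists_enum
  obtain ⟨κ, hκ, hdepth⟩ := exists_strictMono_lt_depth ht
  have hpos : ∀ m, 0 < (t (κ m)).depth := fun m => (Nat.zero_le m).trans_lt (hdepth m)
  obtain ⟨f, hf⟩ := hPFA.exists_separating_coloring {α | Order.IsSuccLimit α}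
    (fun α m => g α ((t (κ m)).depth - 1)) (fun α m => g α ((t (κ m)).width - 1))
    (fun α hα m => (hg α hα).1.monotone (by
      have := DisjointType.depth_lt_width (hpos m)
      omega))
    (fun α hα m => (hg α hα).2.2.1 _)
    (fun α hα γ hγ => ((hg α hα).2.2.2 γ hγ).mono fun m hm => hm.trans ((hg α hα).1.monotone (by
      have := hdepth m
      omega)))
  obtain ⟨α, β, k, hα, hβ, -, hfα, hfβ, htype⟩ := hguess (fun α => κ (f α))
  obtain rfl : κ (f α) = k := hfα
  have hαβ : f α = f β := hκ.injective hfβ.symm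
  have hfirst : ∀ γ, Order.IsSuccLimit γ → ∀ n, firstElems (C γ) n = g γ '' Set.Iio n := by
    intro γ hγ n
    rw [← (hg γ hγ).2.1, firstElems_range (hg γ hγ).1]
  rw [hfirst α hα, hfirst β hβ, DisjointType.opposite_isTypeOf] at htype
  rcases htype with h | h
  · obtain ⟨h1, h2, h3⟩ := h.overlap (hpos _) (hg α hα).1 (hg β hβ).1
    refine h3 ?_
    have := hf α hα β hβ hαβ
    simp only [← hαβ] at this
    exact this h1 h2
  · obtain ⟨h1, h2, h3⟩ := h.overlap (hpos _) (hg β hβ).1 (hg α hα).1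
    refine h3 ?_
    have := hf β hβ α hα hαβ.symm
    simp only [← hαβ] at this
    exact this h1 h2

/-! ### Types of unbounded depth -/

/-- The alternating type `0101…01` of width `n`. -/
def alternatingType (n : ℕ) : DisjointType where
  width := n
  val := fun i => if i.1 % 2 = 0 then 0 else 1
  card_zero := by
    refine Eq.trans ?_ (Fintype.card_fin n)
    symm
    refine Finset.card_bij (fun j _ => ⟨2 * j.1, by omega⟩) (by simp) ?_ ?_
    · intro a _ b _ h
      simp only [Fin.mk.injEq] at h
      exact Fin.ext (by omega)
    · intro i hi
      have h : i.1 % 2 = 0 := by simpa using hi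
      exact ⟨⟨i.1 / 2, by omega⟩, Finset.mem_univ _, Fin.ext (by simp only; omega)⟩
  card_one := by
    refine Eq.trans ?_ (Fintype.card_fin n)
    symm
    refine Finset.card_bij (fun j _ => ⟨2 * j.1 + 1, by omega⟩) (by simp) ?_ ?_
    · intro a _ b _ h
      simp only [Fin.mk.injEq] at h
      exact Fin.ext (by omega)
    · intro i hi
      have h : i.1 % 2 = 1 := by simpa using hi
      exact ⟨⟨i.1 / 2, by omega⟩, Finset.mem_univ _, Fin.ext (by simp only; omega)⟩

theorem depth_alternatingType (n : ℕ) : (alternatingType (n + 1)).depth = n := by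
  have htype : (alternatingType (n + 1)).IsTypeOf ((fun i : ℕ => 2 * i) '' Set.Iio (n + 1))
      ((fun i : ℕ => 2 * i + 1) '' Set.Iio (n + 1)) := by
    refine ⟨Fin.val, Fin.val_strictMono, ?_, ?_⟩
    · ext x
      simp only [Set.mem_image, Set.mem_Iio, DisjointType.positions, alternatingType,
        Set.mem_ofPred_eq]
      constructor
      · rintro ⟨i, hi, rfl⟩
        exact ⟨⟨2 * i, by omega⟩, by simp, rfl⟩
      · rintro ⟨i, hi, rfl⟩
        have h : i.1 % 2 = 0 := by simpa using hi
        exact ⟨i.1 / 2, by omega, by omega⟩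
    · ext x
      simp only [Set.mem_image, Set.mem_Iio, DisjointType.positions, alternatingType,
        Set.mem_ofPred_eq]
      constructor
      · rintro ⟨i, hi, rfl⟩
        exact ⟨⟨2 * i + 1, by omega⟩, by simp, rfl⟩
      · rintro ⟨i, hi, rfl⟩
        have h : i.1 % 2 = 1 := by simpa using hi
        exact ⟨i.1 / 2, by omega, by omega⟩
  have h0 : StrictMono fun i : ℕ => 2 * i := fun a b h => by simp only; omega
  have h1 : StrictMono fun i : ℕ => 2 * i + 1 := fun a b h => by simp only; omega
  rw [← DisjointType.depthOfPair_eq_depth _ htype]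
  refine IsLeast.csInf_eq ⟨⟨n.lt_succ_self, Or.inl ⟨_, isNth_image_Iio h1 n.lt_succ_self, ?_⟩⟩, ?_⟩
  · rintro _ ⟨i, hi, rfl⟩
    have hi' : i < n + 1 := hi
    simp only
    omega
  · rintro k ⟨-, ⟨x, hx, hlt⟩ | ⟨x, hx, hlt⟩⟩
    · obtain ⟨i, hi, rfl⟩ := hx.1
      have hi' : i < n + 1 := hi
      have h2 := hlt (2 * n) ⟨n, n.lt_succ_self, rfl⟩
      obtain rfl : i = n := by simp only at h2; omega
      exact_mod_cast ((isNth_image_Iio h1 i.lt_succ_self).2.symm.trans hx.2).le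
    · obtain ⟨i, hi, rfl⟩ := hx.1
      have hi' : i < n + 1 := hi
      have h2 := hlt (2 * n + 1) ⟨n, n.lt_succ_self, rfl⟩
      simp only at h2
      omega

theorem iSup_depth_alternatingType :
    (⨆ k, ((alternatingType (k + 1)).depth : ℕ∞)) = ⊤ := by
  simp only [depth_alternatingType]
  exact ENat.iSup_natCast

/-! ### Clubs of closure points -/

theorem exists_forall_le_of_countable {s : Set Omega1} (hs : s.Countable) : ∃ b, ∀ x ∈ s, x ≤ b := by
  by_contra! h
  have huniv : (⋃ x ∈ s, Set.Iic x) = Set.univ := by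
    refine Set.eq_univ_of_forall fun b => ?_
    obtain ⟨x, hx, hbx⟩ := h b
    exact Set.mem_biUnion hx hbx.le
  have hc : (Set.univ : Set Omega1).Countable :=
    huniv ▸ hs.biUnion fun x _ => countable_Iic_Omega1 x
  exact not_countable_univ_Omega1 hc

theorem exists_gt_Omega1 (γ : Omega1) : ∃ δ, γ < δ := by
  by_contra! h
  have hc : (Set.univ : Set Omega1).Countable :=
    (countable_Iic_Omega1 γ).mono fun x _ => h x
  exact not_countable_univ_Omega1 hc

/-- The points above `base` that are closed under `h` form a club. -/
theorem isClub_closurePoints (base : Omega1) (h : Omega1 → Omega1) :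
    IsClub {δ | base < δ ∧ ∀ γ < δ, h γ < δ} := by
  refine ⟨?_, ?_⟩
  · intro T hT hne _ δ hδ
    obtain ⟨τ, hτ⟩ := hne
    refine ⟨(hT hτ).1.trans_le (hδ.1 hτ), fun γ hγ => ?_⟩
    obtain ⟨τ, hτ, hγτ⟩ := (lt_isLUB_iff hδ).1 hγ
    exact ((hT hτ).2 γ hγτ).trans_le (hδ.1 hτ)
  · intro a
    -- `H x` lies above `x` and above all values of `h` on `[0, x]`
    have hH : ∀ x, ∃ y, x < y ∧ ∀ γ ≤ x, h γ < y := by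
      intro x
      obtain ⟨b, hb⟩ := exists_forall_le_of_countable ((countable_Iic_Omega1 x).image h)
      obtain ⟨y, hy⟩ := exists_gt_Omega1 (max b x)
      exact ⟨y, (le_max_right _ _).trans_lt hy, fun γ hγ =>
        (hb _ ⟨γ, hγ, rfl⟩).trans_lt ((le_max_left _ _).trans_lt hy)⟩
    choose H hH1 hH2 using hH
    let s : ℕ → Omega1 := fun n => H^[n] (max a base)
    have hs : ∀ n, s (n + 1) = H (s n) := fun n => Function.iterate_succ_apply' H n _
    obtain ⟨b, hb⟩ := exists_forall_le_of_countable (Set.countable_range s)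
    have hne : (upperBounds (Set.range s)).Nonempty := ⟨b, hb⟩
    let δ := wellFounded_lt.min _ hne
    have hδ : IsLUB (Set.range s) δ := ⟨wellFounded_lt.min_mem _ hne, fun x hx =>
      not_lt.1 (wellFounded_lt.not_lt_min _ hx)⟩
    have hlt : ∀ n, s n < δ := fun n =>
      ((hH1 (s n)).trans_eq (hs n).symm).trans_le (hδ.1 ⟨n + 1, rfl⟩)
    refine ⟨δ, ⟨(le_max_right a base).trans_lt (hlt 0), fun γ hγ => ?_⟩,
      (le_max_left a base).trans (hlt 0).le⟩
    obtain ⟨_, ⟨n, rfl⟩, hn⟩ := (lt_isLUB_iff hδ).1 hγ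
    exact ((hH2 (s n) γ hn.le).trans_eq (hs n).symm).trans (hlt (n + 1))

/-! ### Rich families of finite sets -/

/-- A family `A` of sets is `n`-rich if one can choose in turn `n` points, each from an unbounded
set of possible values, so that the set of the chosen points always belongs to `A`. -/
def Rich {X : Type*} [LT X] : ℕ → Set (Set X) → Prop
  | 0, A => ∅ ∈ A
  | n + 1, A => ∀ γ, ∃ x, γ < x ∧ Rich n {u | insert x u ∈ A}

/-- Members of two rich families can be chosen interleaved in any prescribed pattern. -/
theorem Rich.exists_interleaved {X : Type*} [Preorder X] : ∀ (N : ℕ) (w : Fin N → Fin 2)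
    (A : Fin 2 → Set (Set X)), (∀ c, Rich (Finset.univ.filter fun i => w i = c).card (A c)) →
    ∀ γ : X, ∃ e : Fin N → X, StrictMono e ∧ (∀ i, γ < e i) ∧ ∀ c, e '' {i | w i = c} ∈ A c
  | 0, w, A, hA, γ => by
    refine ⟨Fin.elim0, fun i => i.elim0, fun i => i.elim0, fun c => ?_⟩
    have h := hA c
    rw [Finset.univ_eq_empty, Finset.filter_empty, Finset.card_empty] at h
    rw [Set.eq_empty_of_isEmpty {i | w i = c}, Set.image_empty]
    exact h
  | N + 1, w, A, hA, γ => by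
    have h0 := hA (w 0)
    rw [Fin.card_filter_univ_succ, if_pos rfl] at h0
    obtain ⟨x, hx, hrich⟩ := h0 γ
    obtain ⟨e, he, hxe, hmem⟩ := Rich.exists_interleaved N (fun i => w i.succ)
      (Function.update A (w 0) {u | insert x u ∈ A (w 0)}) (by
        intro c
        by_cases hc : c = w 0
        · subst hc
          rw [Function.update_self]
          exact hrich
        · rw [Function.update_of_ne hc]
          have h := hA c
          rwa [Fin.card_filter_univ_succ, if_neg (Ne.symm hc)] at h) x
    have himg : ∀ c, (Fin.cons x e : Fin (N + 1) → X) '' {i | w i = c} =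
        {y | y = x ∧ w 0 = c} ∪ e '' {i | w i.succ = c} := by
      intro c
      ext y
      simp only [Set.mem_image, Set.mem_union, Set.mem_ofPred_eq]
      rw [Fin.exists_fin_succ]
      simp only [Fin.cons_zero, Fin.cons_succ]
      tauto
    refine ⟨Fin.cons x e, ?_, ?_, fun c => ?_⟩
    · intro i j hij
      induction i using Fin.cases with
      | zero =>
        induction j using Fin.cases with
        | zero => exact absurd hij (lt_irrefl _)
        | succ j => simpa using hxe j
      | succ i =>
        induction j using Fin.cases with
        | zero => exact absurd hij (Fin.not_lt_zero _)
        | succ j => simpa using he (Fin.succ_lt_succ_iff.1 hij)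
    · intro i
      induction i using Fin.cases with
      | zero => exact hx
      | succ i => exact hx.trans (hxe i)
    · have h := hmem c
      rw [himg]
      by_cases hc : c = w 0
      · subst hc
        rw [Function.update_self] at h
        rw [show {y | y = x ∧ w 0 = w 0} = {x} by ext y; simp, Set.singleton_union]
        exact h
      · rw [Function.update_of_ne hc] at h
        convert! h using 1
        ext y
        simp [Ne.symm hc]

/-- There is a function such that no set enumerated in its closure points belongs to a family that
is not rich; this is done for countably many families at once. -/
theorem exists_rich_of_closurePoints (A : ℕ → Set (Set Omega1)) : ∃ h : Omega1 → Omega1,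
    ∀ (base : Omega1) (k n : ℕ) (g : ℕ → Omega1), StrictMono g →
      (∀ i, g i ∈ {δ | base < δ ∧ ∀ γ < δ, h γ < δ}) → g '' Set.Iio n ∈ A k → Rich n (A k) := by
  classical
  have hbd : ∀ (k m : ℕ) (s : Finset Omega1), ∃ b, ¬ Rich (m + 1) {u | ↑s ∪ u ∈ A k} →
      ∀ x, b < x → ¬ Rich m {u | insert x ↑s ∪ u ∈ A k} := by
    intro k m s
    by_cases hr : Rich (m + 1) {u | ↑s ∪ u ∈ A k}
    · obtain ⟨x, -⟩ := hr ⟨0, by simp [Ordinal.omega_pos]⟩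
      exact ⟨x, fun h => absurd hr h⟩
    · have hr' := hr
      simp only [Rich, not_forall, not_exists, not_and] at hr'
      obtain ⟨b, hb⟩ := hr'
      refine ⟨b, fun _ x hx => ?_⟩
      convert! hb x hx using 3
      ext u
      simp only [Set.mem_ofPred_eq, Set.insert_union, Set.union_insert]
  choose bd hbd using hbd
  have hh : ∀ γ, ∃ b, ∀ k m (s : Finset Omega1), (s : Set Omega1) ⊆ Set.Iic γ → bd k m s ≤ b := by
    intro γ
    have hc : (Set.univ ×ˢ Set.univ ×ˢ {s : Finset Omega1 | (s : Set Omega1) ⊆ Set.Iic γ} :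
        Set (ℕ × ℕ × Finset Omega1)).Countable :=
      (Set.to_countable _).prod ((Set.to_countable _).prod
        (countable_finset_subset (countable_Iic_Omega1 γ)))
    obtain ⟨b, hb⟩ := exists_forall_le_of_countable
      (hc.image fun p : ℕ × ℕ × Finset Omega1 => bd p.1 p.2.1 p.2.2)
    exact ⟨b, fun k m s hs => hb _ ⟨(k, m, s), ⟨trivial, trivial, hs⟩, rfl⟩⟩
  choose h hh using hh
  refine ⟨h, fun base k n g hg hgD hmem => ?_⟩
  by_contra hr
  -- non-richness persists when the points of `g` are fixed one after the other
  have key : ∀ i ≤ n, ¬ Rich (n - i) {u | g '' Set.Iio i ∪ u ∈ A k} := by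
    intro i
    induction i with
    | zero =>
      intro _
      simpa using hr
    | succ i ih =>
      intro hi
      have h1 := ih (by omega)
      obtain ⟨m, hm⟩ : ∃ m, n - i = m + 1 := ⟨n - i - 1, by omega⟩
      have hs : ((Finset.range i).image g : Set Omega1) = g '' Set.Iio i := by
        simp
      rw [hm, ← hs] at h1
      have h2 := hbd k m _ h1 (g i) ?_
      · rw [show n - (i + 1) = m by omega]
        rw [hs] at h2
        suffices heq : g '' Set.Iio (i + 1) = insert (g i) (g '' Set.Iio i) by rwa [heq]
        ext y
        simp only [Set.mem_image, Set.mem_Iio, Set.mem_insert_iff]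
        constructor
        · rintro ⟨j, hj, rfl⟩
          rcases Nat.lt_succ_iff_lt_or_eq.1 hj with hj | rfl
          · exact Or.inr ⟨j, hj, rfl⟩
          · exact Or.inl rfl
        · rintro (rfl | ⟨j, hj, rfl⟩)
          · exact ⟨i, by omega, rfl⟩
          · exact ⟨j, by omega, rfl⟩
      · obtain ⟨γ, hγ, hsγ⟩ : ∃ γ < g i, g '' Set.Iio i ⊆ Set.Iic γ := by
          rcases Nat.eq_zero_or_pos i with rfl | hpos
          · exact ⟨base, (hgD 0).1, by simp⟩
          · refine ⟨g (i - 1), hg (by omega), ?_⟩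
            rintro _ ⟨j, hj, rfl⟩
            have hj' : j < i := hj
            exact hg.monotone (by omega)
        exact (hh γ k m _ (hs ▸ hsγ)).trans_lt ((hgD i).2 γ hγ)
  have h1 := key n le_rfl
  rw [Nat.sub_self] at h1
  exact h1 (by simpa [Rich] using hmem)

/-! ### Club guessing and disjoint type guessing -/

theorem DisjointType.isTypeOf_empty {t : DisjointType} (ht : t.width = 0) {X : Type*}
    [LinearOrder X] : t.IsTypeOf (∅ : Set X) ∅ := by
  have : IsEmpty (Fin (2 * t.width)) := by
    rw [ht, Nat.mul_zero]
    infer_instance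
  exact ⟨isEmptyElim, fun i => isEmptyElim i, by rw [Set.eq_empty_of_isEmpty (t.positions 0)]; simp,
    by rw [Set.eq_empty_of_isEmpty (t.positions 1)]; simp⟩

/-- A club guessing sequence guesses every sequence of disjoint types. The types of width `0` only
require two points of the same colour, and are dealt with by staying above all bounded colour
classes. -/
theorem ClubGuessing.dtg (hCG : ClubGuessing) : DTG := by
  obtain ⟨C, hC, hguess⟩ := hCG
  intro t
  refine ⟨C, hC, fun f => ?_⟩
  obtain ⟨g, hg⟩ := hC.exists_enum
  have hfirst : ∀ γ, Order.IsSuccLimit γ → ∀ n, firstElems (C γ) n = g γ '' Set.Iio n := by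
    intro γ hγ n
    rw [← (hg γ hγ).2.1, firstElems_range (hg γ hγ).1]
  let A : ℕ → Set (Set Omega1) := fun k =>
    {u | ∃ α, Order.IsSuccLimit α ∧ f α = k ∧ firstElems (C α) (t k).width = u}
  obtain ⟨h, hh⟩ := exists_rich_of_closurePoints A
  -- `base` bounds every colour class that is bounded
  have hbase : ∀ k, ∃ b, (∃ α, Order.IsSuccLimit α ∧ f α = k ∧ b < α) →
      ∀ γ, ∃ β, Order.IsSuccLimit β ∧ f β = k ∧ γ < β := by
    intro k
    by_cases hk : ∀ γ, ∃ β, Order.IsSuccLimit β ∧ f β = k ∧ γ < β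
    · exact ⟨⟨0, by simp [Ordinal.omega_pos]⟩, fun _ => hk⟩
    · obtain ⟨b, hb⟩ := not_forall.1 hk
      exact ⟨b, fun h => absurd h hb⟩
  choose b hb using hbase
  obtain ⟨base, hbase⟩ := exists_forall_le_of_countable (Set.countable_range b)
  obtain ⟨α, hα, hCα⟩ := hguess _ (isClub_closurePoints base h)
  obtain ⟨hmono, hrange, hgα, -⟩ := hg α hα
  have hgD : ∀ i, g α i ∈ {δ | base < δ ∧ ∀ γ < δ, h γ < δ} := fun i =>
    hCα (hrange ▸ Set.mem_range_self i)
  set k := f α with hk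
  rcases Nat.eq_zero_or_pos (t k).width with h0 | hpos
  · obtain ⟨β, hβ, hfβ, hαβ⟩ := hb k ⟨α, hα, rfl,
      (hbase _ ⟨k, rfl⟩).trans_lt ((hgD 0).1.trans (hgα 0))⟩ α
    refine ⟨α, β, k, hα, hβ, hαβ, rfl, hfβ, Or.inl ?_⟩
    have hempty : ∀ γ, firstElems (C γ) (t k).width = ∅ := by
      intro γ
      ext x
      simp [firstElems, h0]
    rw [hempty, hempty]
    exact DisjointType.isTypeOf_empty h0
  · have hrich : Rich (t k).width (A k) := hh base k _ (g α) hmono hgD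
      ⟨α, hα, rfl, hfirst α hα _⟩
    obtain ⟨e, he, -, hmem⟩ := Rich.exists_interleaved _ (t k).val (fun _ => A k) (by
      intro c
      have hc : (Finset.univ.filter fun i => (t k).val i = c).card = (t k).width := by
        rcases (by revert c; decide : c = 0 ∨ c = 1) with rfl | rfl
        · exact (t k).card_zero
        · exact (t k).card_one
      rw [hc]
      exact hrich) base
    obtain ⟨α₀, hα₀, hf₀, he₀⟩ := hmem 0
    obtain ⟨α₁, hα₁, hf₁, he₁⟩ := hmem 1
    have htype : (t k).IsTypeOf (firstElems (C α₀) (t k).width) (firstElems (C α₁) (t k).width) :=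
      ⟨e, he, he₀, he₁⟩
    rcases lt_trichotomy α₀ α₁ with hlt | rfl | hlt
    · exact ⟨α₀, α₁, k, hα₀, hα₁, hlt, hf₀, hf₁, Or.inl htype⟩
    · have hd := htype.disjoint
      rw [disjoint_self, hfirst α₀ hα₀] at hd
      exact absurd (hd.le ⟨0, hpos, rfl⟩) (Set.notMem_empty _)
    · exact ⟨α₁, α₀, k, hα₁, hα₀, hlt, hf₁, hf₀,
        Or.inr (DisjointType.opposite_isTypeOf.2 htype)⟩

theorem mainTheorem3 :
    (PFAOmega1 → ∀ t : ℕ → DisjointType, (⨆ k, ((t k).depth : ℕ∞)) = ⊤ →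
      ¬ ∃ C : Omega1 → Set Omega1, IsGuessingSequence C t) ∧
    (PFAOmega1 → ¬ DTG) ∧
    (ClubGuessing → DTG) :=
  ⟨fun hPFA _ ht ⟨C, hC⟩ => hPFA.not_isGuessingSequence ht C hC,
    fun hPFA hDTG => by
      obtain ⟨C, hC⟩ := hDTG fun k => alternatingType (k + 1)
      exact hPFA.not_isGuessingSequence iSup_depth_alternatingType C hC,
    fun hCG => hCG.dtg⟩
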